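/- A (finite) Markov decision process is a tuple $\mathcal M=(S,A,\delta)$ with finite sets $S$ of states and $A$ of actions and a partial function $\delta$ from $S\times A$ to the rational probability distributions on $S$, such that for every state $s$ the set $A(s)$ of actions $a$ for which $\delta(s,a)$ is defined is non-empty. A run is a sequence $\rho=s_0a_0s_1a_1\ldots$ such that, for all $i$, $\delta(s_i,a_i)$ is defined and $\delta(s_i,a_i)(s_{i+1})>0$; its suffix from the $n$-th state is $\rho[n,\infty]=s_na_ns_{n+1}a_{n+1}\ldots$. Histories are the finite prefixes $s_0a_0\ldots a_{n-1}s_n$ of runs. A strategy $\sigma$ maps every history ending in a state $s$ to a rational probability distribution on $A$ supported in $A(s)$. It is pure if all these distributions are Dirac. It is finite-memory if it is encoded by a Mealy machine with a finite set $Q$ of memory states, a rational initial distribution on $Q$, a next action function mapping each $(s,q)\in S\times Q$ to a rational distribution on $A$ supported in $A(s)$, and an update function $A\times S\times Q\to Q$ (the memory is updated with the current state and the chosen action); "encoded" means that at every history whose actions the machine chooses with positive probability, $\sigma$ gives the conditional distribution of the machine's next action. Let $\mathbb P^\sigma_{\mathcal M,s}$ be the probability measure on $(SA)^\omega$ induced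 by $\sigma$ from the initial state $s$. Let $\Omega$ be $\mathsf{mp}$, with a weight function $w\colon A\to\mathbb Z$, or $\mathsf{par}$, with a priority function $p\colon S\to\mathbb N$. For a window size $\lambda\in\mathbb N$, $\lambda>0$, let $$\mathsf{GW}_{\mathsf{mp}}(\lambda)=\Big\{\rho \;\Big|\; \exists\, l<\lambda,\ \tfrac1{l+1}\sum_{i=0}^{l}w(a_i)\ge 0\Big\},$$ $$\mathsf{GW}_{\mathsf{par}}(\lambda)=\big\{\rho \mid \exists\, l<\lambda,\ p(s_l)\text{ is even and } p(s_l)<p(s_k)\text{ for all }k<l\big\},$$ $$\mathsf{DFW}_\Omega(\lambda)=\{\rho\mid\forall\, j\ge0,\ \rho[j,\infty]\in\mathsf{GW}_\Omega(\lambda)\},\qquad \mathsf{FW}_\Omega(\lambda)=\{\rho\mid\exists\, i\ge0,\ \rho[i,\infty]\in\mathsf{DFW}_\Omega(\lambda)\},$$ where $\rho=s_0a_0s_1a_1\ldots$ ranges over the runs of $\mathcal M$. **Theorem.** Let $\mathcal M=(S,A,\delta)$ be a Markov decision process, $s\in S$, $\lambda>0$, $\Omega\in\{\mathsf{mp},\mathsf{par}\}$,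 $E\in\{\mathsf{DFW}_\Omega(\lambda),\mathsf{FW}_\Omega(\lambda)\}$ and $\alpha\in[0,1]\cap\mathbb Q$. If there is a strategy $\sigma$ with $\mathbb P^\sigma_{\mathcal M,s}[E]\ge\alpha$, then there is a pure finite-memory strategy $\sigma'$ with $\mathbb P^{\sigma'}_{\mathcal M,s}[E]\ge\alpha$. -/

import Mathlib

open MeasureTheory ProbabilityTheory
open scoped ENNReal

noncomputable section

/-- A distribution is rational if all its point masses are rational numbers. -/
def PMF.IsRational {X : Type*} (p : PMF X) : Prop :=
  ∀ x, ∃ q : ℚ, (p x).toReal = (q : ℝ)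

/-- A Markov decision process with states `S` and actions `A`. The transition function is partial:
`δ s a = none` means that `a` is not available in `s`. Every state has an available action. -/
structure MDP (S A : Type*) where
  δ : S → A → Option (PMF S)
  rational : ∀ s a p, δ s a = some p → p.IsRational
  deadlockFree : ∀ s, ∃ a, (δ s a).isSome

namespace MDP

variable {S A : Type*}

/-- The set `A(s)` of actions available in `s`. -/
def avail (M : MDP S A) (s : S) : Set A := {a | (M.δ s a).isSome}

/-- `δ(s, a, t)`, read as `0` if `a` is not available in `s`. -/
def prob (M : MDP S A) (s : S) (a : A) (t : S) : ℝ≥0∞ := (M.δ s a).elim 0 (fun p => p t)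

/-- `(s, a, t) ∈ δ`: the transition from `s` to `t` under `a` has positive probability. -/
def Edge (M : MDP S A) (s : S) (a : A) (t : S) : Prop := 0 < M.prob s a t

/-- The set of runs. The run `s₀ a₀ s₁ a₁ …` is the sequence of the pairs `(sᵢ, aᵢ)`. -/
def Runs (M : MDP S A) : Set (ℕ → S × A) :=
  {ρ | ∀ i, M.Edge (ρ i).1 (ρ i).2 (ρ (i + 1)).1}

/-- `s₀ a₀ … aₙ₋₁ sₙ` is a history; it is given by the list of the pairs `(sᵢ, aᵢ)` for `i < n`
and by its last state `sₙ`. -/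
def IsHist (M : MDP S A) (l : List (S × A)) (t : S) : Prop :=
  l.IsChain (fun x y => M.Edge x.1 x.2 y.1) ∧ ∀ x ∈ l.getLast?, M.Edge x.1 x.2 t

/-- The histories `s₀ a₀ … aₙ₋₁ sₙ`: lists of pairs `(sᵢ, aᵢ)` together with the last state. -/
def Hist (M : MDP S A) : Type _ := {h : List (S × A) × S // M.IsHist h.1 h.2}

/-- The last state of a history. -/
def Hist.last {M : MDP S A} (h : M.Hist) : S := h.1.2

/-- The history that consists of a single state. -/
def Hist.single (M : MDP S A) (s : S) : M.Hist :=
  ⟨([], s), List.isChain_nil, by simp⟩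

/-- A (history-dependent, randomised) strategy. -/
structure Strategy (M : MDP S A) where
  act : M.Hist → PMF A
  rational : ∀ h, (act h).IsRational
  supp : ∀ h, (act h).support ⊆ M.avail h.last

/-- A strategy is pure if it maps all histories to Dirac distributions. -/
def Strategy.IsPure {M : MDP S A} (σ : M.Strategy) : Prop := ∀ h, ∃ a, σ.act h = PMF.pure a

/-- A Mealy machine with set of memory states `Q`: an initial distribution on memory states, a next
action function, and a memory update function. -/
structure Mealy (M : MDP S A) (Q : Type*) where
  init : PMF Q
  next : S → Q → PMF A
  upd : A → S → Q → Q
  init_rational : init.IsRational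
  next_rational : ∀ s q, (next s q).IsRational
  next_supp : ∀ s q, (next s q).support ⊆ M.avail s

namespace Mealy

variable {M : MDP S A} {Q : Type*}

/-- The memory state reached from `q` after reading `s₀ a₀ … sₙ₋₁ aₙ₋₁`. -/
def memory (N : M.Mealy Q) : Q → List (S × A) → Q
  | q, [] => q
  | q, x :: l => N.memory (N.upd x.2 x.1 q) l

/-- The probability that the machine, started in the memory state `q`, chooses the actions
`a₀, …, aₙ₋₁` when the states visited are `s₀, …, sₙ₋₁`. -/
def weight (N : M.Mealy Q) : Q → List (S × A) → ℝ≥0∞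
  | _, [] => 1
  | q, x :: l => N.next x.1 q x.2 * N.weight (N.upd x.2 x.1 q) l

/-- The machine encodes `σ`: after each history `h`, the distribution `σ(h)` is the conditional
distribution of the next action of the machine, given that the machine has chosen the actions along
`h`. The conditional probability is written with its denominator cleared, so that there is no
constraint on `σ` at the histories whose actions the machine chooses with probability zero. -/
def Encodes (N : M.Mealy Q) (σ : M.Strategy) : Prop :=
  ∀ (h : M.Hist) (a : A),
    (∑' q, N.init q * N.weight q h.1.1) * σ.act h a =
      ∑' q, N.init q * N.weight q h.1.1 * N.next h.last (N.memory q h.1.1) a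

end Mealy

/-- A strategy is finite-memory if a Mealy machine with finitely many memory states encodes it. -/
def Strategy.IsFiniteMemory {M : MDP S A} (σ : M.Strategy) : Prop :=
  ∃ (Q : Type) (_ : Finite Q) (N : M.Mealy Q), N.Encodes σ

open Classical in
/-- The strategy on arbitrary finite sequences. The value at a sequence that is not a history is
irrelevant, since such sequences have probability zero. -/
def Strategy.actExt {M : MDP S A} (σ : M.Strategy) (l : List (S × A)) (t : S) : PMF A :=
  if h : M.IsHist l t then σ.act ⟨(l, t), h⟩ else σ.act (Hist.single M t)

/-- The law of the next pair `(t, b)` after `s₀ a₀ … sₙ aₙ`: the state `t` is drawn from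
`δ(sₙ, aₙ)` and then the action `b` from `σ(s₀ a₀ … sₙ aₙ t)`. The value for an action `aₙ` that is
not available in `sₙ` is irrelevant, since strategies never choose such an action. -/
def Strategy.step {M : MDP S A} (σ : M.Strategy) (n : ℕ) (x : (i : Finset.Iic n) → S × A) :
    PMF (S × A) :=
  let last := x ⟨n, Finset.mem_Iic.2 le_rfl⟩
  let l := List.ofFn (fun i : Fin (n + 1) => x ⟨i, Finset.mem_Iic.2 (Nat.le_of_lt_succ i.2)⟩)
  ((M.δ last.1 last.2).getD (PMF.pure last.1)).bind
    (fun t => (σ.actExt l t).map (fun b => (t, b)))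

section Law

variable [Finite S] [Finite A] [MeasurableSpace S] [MeasurableSpace A]
  [DiscreteMeasurableSpace S] [DiscreteMeasurableSpace A]

/-- `Strategy.step` as a transition kernel. -/
def Strategy.kernel {M : MDP S A} (σ : M.Strategy) (n : ℕ) :
    Kernel ((i : Finset.Iic n) → S × A) (S × A) :=
  Kernel.ofFunOfCountable (fun x => (σ.step n x).toMeasure)

instance {M : MDP S A} (σ : M.Strategy) (n : ℕ) : IsMarkovKernel (σ.kernel n) :=
  ⟨fun x => PMF.toMeasure.isProbabilityMeasure (σ.step n x)⟩

/-- The probability measure on `(SA)^ω` that is induced by the strategy `σ` from the initial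
state `s`. -/
def Strategy.law {M : MDP S A} (σ : M.Strategy) (s : S) : Measure (ℕ → S × A) :=
  Kernel.trajMeasure (X := fun _ => S × A)
    (((σ.act (Hist.single M s)).map (fun a => (s, a))).toMeasure) σ.kernel

end Law

/-- The data of a window objective: a weight function on actions (mean-payoff variant) or a
priority function on states (parity variant). -/
inductive Variant (S A : Type*) where
  | mp (w : A → ℤ)
  | par (p : S → ℕ)

/-- The suffix `ρ[n, ∞]`. -/
def suffix (ρ : ℕ → S × A) (n : ℕ) : ℕ → S × A := fun k => ρ (n + k)

/-- The mean-payoff `MP(ρ[0, n])` of the prefix up to the `n`-th state, for `n > 0`. -/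
def meanPayoff (w : A → ℤ) (ρ : ℕ → S × A) (n : ℕ) : ℚ :=
  (1 / (n : ℚ)) * ∑ i ∈ Finset.range n, (w (ρ i).2 : ℚ)

/-- The good window objective with window size `lam`. -/
def GW (M : MDP S A) : Variant S A → ℕ → Set (ℕ → S × A)
  | .mp w, lam => {ρ | ρ ∈ M.Runs ∧ ∃ l < lam, 0 ≤ meanPayoff w ρ (l + 1)}
  | .par p, lam =>
      {ρ | ρ ∈ M.Runs ∧ ∃ l < lam, p (ρ l).1 % 2 = 0 ∧ ∀ k < l, p (ρ l).1 < p (ρ k).1}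

/-- The direct fixed window objective with window size `lam`. -/
def DFW (M : MDP S A) (Ω : Variant S A) (lam : ℕ) : Set (ℕ → S × A) :=
  {ρ | ρ ∈ M.Runs ∧ ∀ j, suffix ρ j ∈ M.GW Ω lam}

/-- The (prefix-independent) fixed window objective with window size `lam`. -/
def FW (M : MDP S A) (Ω : Variant S A) (lam : ℕ) : Set (ℕ → S × A) :=
  {ρ | ρ ∈ M.Runs ∧ ∃ i, suffix ρ i ∈ M.DFW Ω lam}

end MDP

end

/- Both objectives are, up to the null set of sequences that are not runs, co-Büchi objectives of
regular languages: a run is in `FW` if only finitely many of its prefixes end with a bad window, and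
in `DFW` if only finitely many of its prefixes contain one.

In the product with an automaton for such a language, let each visit to an accepting state cost a
factor `γ < 1`. The decreasing limit of value iteration from `1` is a fixed point of the Bellman
operator, and a memoryless choice of actions attains it. The limit is at least `γ ^ m` times the
probability of at most `m` visits under any strategy, and at most the probability of finitely many
visits under this choice. There are only finitely many choices, so a single one works for `γ`
arbitrarily close to `1`, and it is optimal for the co-Büchi objective. -/

namespace MDP

open Filter Topology

section Words

variable {α : Type*}

/-- The word `x₀ x₁ … xₙ₋₁`, the prefix of length `n` of the infinite word `x`. -/
def pref (x : ℕ → α) (n : ℕ) : List α := List.ofFn fun i : Fin n => x i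

lemma length_pref (x : ℕ → α) (n : ℕ) : (pref x n).length = n := List.length_ofFn

lemma pref_add (x : ℕ → α) (m n : ℕ) :
    pref x (m + n) = pref x m ++ pref (fun k => x (m + k)) n := List.ofFn_add

lemma pref_succ (x : ℕ → α) (n : ℕ) : pref x (n + 1) = pref x n ++ [x n] := List.ofFn_succ_last

lemma pref_inj {x y : ℕ → α} {n : ℕ} : pref x n = pref y n ↔ ∀ i < n, x i = y i := by
  simp [pref, List.ofFn_inj, funext_iff, Fin.forall_iff]

lemma take_pref (x : ℕ → α) {k n : ℕ} (h : k ≤ n) : (pref x n).take k = pref x k := by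
  obtain ⟨m, rfl⟩ := Nat.exists_eq_add_of_le h
  rw [pref_add, List.take_left' (length_pref x k)]

lemma measurable_comp_pref {β : Type*} [MeasurableSpace β] [Countable α] [MeasurableSpace α]
    [DiscreteMeasurableSpace α] (f : List α → β) (n : ℕ) :
    Measurable fun x : ℕ → α => f (pref x n) :=
  (Measurable.of_discrete (f := fun v : Fin n → α => f (List.ofFn v))).comp
    (measurable_pi_lambda _ fun i => measurable_pi_apply (i : ℕ))

/-- The co-Büchi objective of a language: only finitely many prefixes belong to `L`. If `L` is
accepted by a deterministic automaton, then these are the words on which the automaton visits its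
accepting states finitely often, so the accepting states play the role of the bad ones. -/
def coBuchi (L : Language α) : Set (ℕ → α) := {x | ∀ᶠ n in atTop, pref x n ∉ L}

open Classical in
/-- The number of proper prefixes of a word that belong to `L`. -/
noncomputable def visits (L : Language α) (l : List α) : ℕ :=
  Nat.count (fun k => l.take k ∈ L) l.length

open Classical in
lemma visits_pref (L : Language α) (x : ℕ → α) (n : ℕ) :
    visits L (pref x n) = Nat.count (fun k => pref x k ∈ L) n := by
  rw [visits, length_pref, Nat.count_eq_card_filter_range, Nat.count_eq_card_filter_range]
  refine congrArg Finset.card (Finset.filter_congr fun k hk => ?_)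
  rw [take_pref x (Finset.mem_range.1 hk).le]

open Classical in
lemma visits_pref_succ (L : Language α) (x : ℕ → α) (n : ℕ) :
    visits L (pref x (n + 1)) = visits L (pref x n) + if pref x n ∈ L then 1 else 0 := by
  rw [visits_pref, visits_pref, Nat.count_succ]

lemma visits_pref_mono (L : Language α) (x : ℕ → α) : Monotone fun n => visits L (pref x n) := by
  classical
  simpa only [visits_pref] using Nat.count_monotone _

lemma coBuchi_eq_iUnion (L : Language α) :
    coBuchi L = ⋃ m, {x | ∀ n, visits L (pref x n) ≤ m} := by
  classical
  ext x
  simp only [coBuchi, Set.mem_iUnion, Set.mem_ofPred_eq, visits_pref, ← Nat.cofinite_eq_atTop,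
    eventually_cofinite, not_not]
  refine ⟨fun h => ⟨_, Nat.count_le_card h⟩, ?_⟩
  rintro ⟨m, hm⟩
  by_contra hinf
  obtain ⟨n, hn⟩ := Nat.surjective_count_of_infinite_setOfPred hinf (m + 1)
  exact (hm n).not_gt (hn ▸ m.lt_succ_self)

lemma iInf_pow_visits_le (L : Language α) {γ : ℝ≥0∞} (hγ : γ < 1) (x : ℕ → α) :
    ⨅ n, γ ^ visits L (pref x n) ≤ (coBuchi L).indicator 1 x := by
  by_cases hx : x ∈ coBuchi L
  · rw [Set.indicator_of_mem hx]
    exact iInf_le_of_le 0 (pow_le_one' hγ.le _)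
  · have hunbounded (m : ℕ) : ∃ n, m ≤ visits L (pref x n) := by
      by_contra! h
      rw [coBuchi_eq_iUnion] at hx
      exact hx (Set.mem_iUnion.2 ⟨m, fun n => (h n).le⟩)
    refine (ge_of_tendsto' (ENNReal.tendsto_pow_atTop_nhds_zero_of_lt_one hγ) fun m => ?_).trans
      zero_le
    obtain ⟨n, hn⟩ := hunbounded m
    exact iInf_le_of_le n (pow_le_pow_right_of_le_one' hγ.le hn)

lemma measurableSet_visits_le [Countable α] [MeasurableSpace α] [DiscreteMeasurableSpace α]
    (L : Language α) (m : ℕ) : MeasurableSet {x : ℕ → α | ∀ n, visits L (pref x n) ≤ m} := by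
  rw [Set.ofPred_forall]
  exact .iInter fun n => measurableSet_le (measurable_comp_pref _ n) measurable_const

lemma measurableSet_coBuchi [Countable α] [MeasurableSpace α] [DiscreteMeasurableSpace α]
    (L : Language α) : MeasurableSet (coBuchi L) := by
  rw [coBuchi_eq_iUnion]
  exact .iUnion (measurableSet_visits_le L)

end Words

section Regular

variable {α : Type*}

lemma mem_top_mul {L : Language α} {x : List α} : x ∈ ⊤ * L ↔ ∃ w ∈ L, w <:+ x := by
  rw [Language.mem_mul]
  constructor
  · rintro ⟨u, -, w, hw, rfl⟩
    exact ⟨w, hw, List.suffix_append _ _⟩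
  · rintro ⟨w, hw, u, rfl⟩
    exact ⟨u, trivial, w, hw, rfl⟩

lemma mem_mul_top {L : Language α} {x : List α} : x ∈ L * ⊤ ↔ ∃ w ∈ L, w <+: x := by
  rw [Language.mem_mul]
  constructor
  · rintro ⟨w, hw, u, -, rfl⟩
    exact ⟨w, hw, List.prefix_append _ _⟩
  · rintro ⟨w, hw, u, rfl⟩
    exact ⟨w, hw, u, trivial, rfl⟩

lemma append_mem_top_mul_iff {W : Language α} {n : ℕ} (hW : ∀ w ∈ W, w.length = n)
    {u v : List α} (hv : v.length = n) : u ++ v ∈ ⊤ * W ↔ v ∈ W := by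
  refine ⟨fun h => ?_, fun h => Language.append_mem_mul trivial h⟩
  obtain ⟨w, hw, hwv⟩ := mem_top_mul.1 h
  have hlen : w.length = v.length := (hW w hw).trans hv.symm
  rwa [← (List.suffix_of_suffix_length_le hwv (List.suffix_append u v) hlen.le).eq_of_length hlen]

lemma isRegular_top_mul [Finite α] {W : Language α} {n : ℕ} (hW : ∀ w ∈ W, w.length ≤ n) :
    (⊤ * W).IsRegular := by
  have hlast (u : List α) :
      (⊤ * W).leftQuotient (u.drop (u.length - n)) = (⊤ * W).leftQuotient u := by
    ext y
    simp only [Language.mem_leftQuotient, mem_top_mul]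
    refine exists_congr fun w => and_congr_right fun hw => ?_
    have hsuff : u.drop (u.length - n) ++ y <:+ u ++ y := by
      rw [← List.drop_append_of_le_length (Nat.sub_le _ _)]
      exact List.drop_suffix _ _
    refine ⟨fun h => h.trans hsuff, fun h => List.suffix_of_suffix_length_le h hsuff ?_⟩
    have := hW w hw
    have := h.length_le
    simp only [List.length_append, List.length_drop] at this ⊢
    omega
  refine .of_finite_range_leftQuotient
    (((List.finite_length_le α n).image (⊤ * W).leftQuotient).subset ?_)
  rintro _ ⟨u, rfl⟩
  refine ⟨u.drop (u.length - n), ?_, hlast u⟩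
  simp only [Set.mem_ofPred_eq, List.length_drop]
  omega

lemma isRegular_mul_top {L : Language α} (hL : L.IsRegular) : (L * ⊤).IsRegular := by
  have hquot (u : List α) : (L * ⊤).leftQuotient u = ⊤ ∨
      (L * ⊤).leftQuotient u = L.leftQuotient u * ⊤ := by
    by_cases hu : u ∈ L * ⊤
    · left
      obtain ⟨w, hw, hwu⟩ := mem_mul_top.1 hu
      exact top_unique fun y _ => mem_mul_top.2 ⟨w, hw, hwu.trans (List.prefix_append u y)⟩
    · right
      ext y
      simp only [Language.mem_leftQuotient, mem_mul_top] at hu ⊢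
      constructor
      · rintro ⟨w, hw, hwy⟩
        obtain h | h := le_total w.length u.length
        · exact absurd ⟨w, hw, List.prefix_of_prefix_length_le hwy (List.prefix_append u y) h⟩ hu
        · obtain ⟨v, rfl⟩ := List.prefix_of_prefix_length_le (List.prefix_append u y) hwy h
          exact ⟨v, hw, (List.prefix_append_right_inj u).1 hwy⟩
      · rintro ⟨v, hv, hvy⟩
        exact ⟨u ++ v, hv, (List.prefix_append_right_inj u).2 hvy⟩
  refine .of_finite_range_leftQuotient
    (((hL.finite_range_leftQuotient.image (· * ⊤)).insert ⊤).subset ?_)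
  rintro _ ⟨u, rfl⟩
  exact (hquot u).imp id fun h => ⟨_, ⟨u, rfl⟩, h.symm⟩

lemma coBuchi_mul_top (L : Language α) : coBuchi (L * ⊤) = {x | ∀ n, pref x n ∉ L} := by
  ext x
  constructor
  · intro h n hn
    obtain ⟨m, hm, hnm⟩ := (h.and (eventually_ge_atTop n)).exists
    obtain ⟨k, rfl⟩ := Nat.exists_eq_add_of_le hnm
    rw [pref_add] at hm
    exact hm (Language.append_mem_mul hn trivial)
  · refine fun h => .of_forall fun n hn => ?_
    obtain ⟨w, hw, hwn⟩ := mem_mul_top.1 hn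
    have hlen : w.length ≤ n := by simpa only [length_pref] using hwn.length_le
    rw [List.prefix_iff_eq_take, take_pref x hlen] at hwn
    exact h w.length (hwn ▸ hw)

end Regular

variable {S A Q : Type*} {M : MDP S A}

section Windows

variable {Ω : Variant S A} {lam : ℕ} {ρ ρ' : ℕ → S × A}

lemma suffix_mem_runs (hρ : ρ ∈ M.Runs) (n : ℕ) : suffix ρ n ∈ M.Runs := fun i => hρ (n + i)

lemma suffix_suffix (ρ : ℕ → S × A) (i j : ℕ) : suffix (suffix ρ i) j = suffix ρ (i + j) := by
  funext k
  simp only [suffix, add_assoc]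

lemma meanPayoff_congr (w : A → ℤ) {n : ℕ} (h : ∀ i < n, ρ i = ρ' i) :
    meanPayoff w ρ n = meanPayoff w ρ' n :=
  congrArg _ (Finset.sum_congr rfl fun i hi => by rw [h i (Finset.mem_range.1 hi)])

lemma mem_GW_congr (hρ : ρ ∈ M.Runs) (hρ' : ρ' ∈ M.Runs) (h : ∀ i < lam, ρ i = ρ' i) :
    ρ ∈ M.GW Ω lam ↔ ρ' ∈ M.GW Ω lam := by
  cases Ω with
  | mp w =>
    refine and_congr (iff_of_true hρ hρ') (exists_congr fun l => and_congr_right fun hl => ?_)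
    rw [meanPayoff_congr w fun i hi => h i (hi.trans_le hl)]
  | par p =>
    refine and_congr (iff_of_true hρ hρ') (exists_congr fun l => and_congr_right fun hl => ?_)
    rw [h l hl]
    refine and_congr_right' (forall₂_congr fun k hk => ?_)
    rw [h k (hk.trans hl)]

/-- The bad windows: the prefixes of length `lam` of the runs that do not start with a good
window. -/
def badWindows (M : MDP S A) (Ω : Variant S A) (lam : ℕ) : Language (S × A) :=
  (pref · lam) '' (M.Runs \ M.GW Ω lam)

lemma length_of_mem_badWindows {w : List (S × A)} (hw : w ∈ M.badWindows Ω lam) :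
    w.length = lam := by
  obtain ⟨ρ, -, rfl⟩ := hw
  exact length_pref ρ lam

lemma pref_mem_badWindows_iff (hρ : ρ ∈ M.Runs) :
    pref ρ lam ∈ M.badWindows Ω lam ↔ ρ ∉ M.GW Ω lam := by
  refine ⟨?_, fun h => ⟨ρ, ⟨hρ, h⟩, rfl⟩⟩
  rintro ⟨ρ', ⟨hρ', hbad⟩, h⟩
  rwa [← mem_GW_congr hρ' hρ (pref_inj.1 h)]

lemma pref_add_mem_top_mul_badWindows_iff (hρ : ρ ∈ M.Runs) (j : ℕ) :
    pref ρ (j + lam) ∈ ⊤ * M.badWindows Ω lam ↔ suffix ρ j ∉ M.GW Ω lam := by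
  rw [pref_add, append_mem_top_mul_iff (fun _ => length_of_mem_badWindows) (length_pref _ _)]
  exact pref_mem_badWindows_iff (suffix_mem_runs hρ j)

lemma mem_DFW_iff_coBuchi (hρ : ρ ∈ M.Runs) :
    ρ ∈ M.DFW Ω lam ↔ ρ ∈ coBuchi (⊤ * M.badWindows Ω lam * ⊤) := by
  rw [coBuchi_mul_top]
  refine (and_iff_right hρ).trans ⟨fun h n hn => ?_, fun h j => ?_⟩
  · obtain ⟨w, hw, hwn⟩ := mem_top_mul.1 hn
    have hlam : lam ≤ n := by
      simpa only [length_of_mem_badWindows hw, length_pref] using hwn.length_le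
    obtain ⟨j, rfl⟩ := Nat.exists_eq_add_of_le' hlam
    exact (pref_add_mem_top_mul_badWindows_iff hρ j).1 hn (h j)
  · exact not_not.1 (mt (pref_add_mem_top_mul_badWindows_iff hρ j).2 (h _))

lemma mem_FW_iff_coBuchi (hρ : ρ ∈ M.Runs) :
    ρ ∈ M.FW Ω lam ↔ ρ ∈ coBuchi (⊤ * M.badWindows Ω lam) := by
  calc ρ ∈ M.FW Ω lam ↔ ∃ i, ∀ j, suffix ρ (i + j) ∈ M.GW Ω lam := by
        simp only [FW, DFW, Set.mem_ofPred_eq, hρ, suffix_mem_runs hρ, suffix_suffix, true_and]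
    _ ↔ ∀ᶠ j in atTop, suffix ρ j ∈ M.GW Ω lam := by
        rw [eventually_atTop]
        refine exists_congr fun i => ⟨fun h j hij => ?_, fun h j => h _ (Nat.le_add_right i j)⟩
        rw [← Nat.add_sub_cancel' hij]
        exact h _
    _ ↔ ∀ᶠ j in atTop, pref ρ (j + lam) ∉ ⊤ * M.badWindows Ω lam := by
        simp only [pref_add_mem_top_mul_badWindows_iff hρ, not_not]
    _ ↔ ρ ∈ coBuchi (⊤ * M.badWindows Ω lam) := by
        rw [coBuchi, Set.mem_ofPred_eq]
        conv_rhs => rw [← map_add_atTop_eq_nat lam, eventually_map]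

lemma exists_isRegular_forall_mem_iff_coBuchi [Finite S] [Finite A]
    {E : Set (ℕ → S × A)} (hE : E = M.DFW Ω lam ∨ E = M.FW Ω lam) :
    ∃ L : Language (S × A), L.IsRegular ∧ ∀ ρ ∈ M.Runs, ρ ∈ E ↔ ρ ∈ coBuchi L := by
  have hreg : (⊤ * M.badWindows Ω lam).IsRegular :=
    isRegular_top_mul fun _ hw => (length_of_mem_badWindows hw).le
  obtain rfl | rfl := hE
  · exact ⟨_, isRegular_mul_top hreg, fun ρ hρ => mem_DFW_iff_coBuchi hρ⟩
  · exact ⟨_, hreg, fun ρ hρ => mem_FW_iff_coBuchi hρ⟩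

end Windows

section Law

lemma Strategy.actExt_nil (σ : M.Strategy) (s : S) : σ.actExt [] s = σ.act (Hist.single M s) := by
  unfold actExt
  split_ifs <;> rfl

lemma Strategy.support_actExt_subset (σ : M.Strategy) (l : List (S × A)) (t : S) :
    (σ.actExt l t).support ⊆ M.avail t := by
  unfold actExt
  split_ifs with h
  · exact σ.supp ⟨(l, t), h⟩
  · exact σ.supp (Hist.single M t)

lemma Strategy.step_frestrictLe (σ : M.Strategy) (n : ℕ) (ρ : ℕ → S × A) :
    σ.step n (Preorder.frestrictLe n ρ) =
      ((M.δ (ρ n).1 (ρ n).2).getD (PMF.pure (ρ n).1)).bind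
        fun t => (σ.actExt (pref ρ (n + 1)) t).map (Prod.mk t) := rfl

lemma Strategy.mem_support_step {σ : M.Strategy} {n : ℕ} {ρ : ℕ → S × A} {y : S × A} :
    y ∈ (σ.step n (Preorder.frestrictLe n ρ)).support ↔
      y.1 ∈ ((M.δ (ρ n).1 (ρ n).2).getD (PMF.pure (ρ n).1)).support ∧
        y.2 ∈ (σ.actExt (pref ρ (n + 1)) y.1).support := by
  obtain ⟨t, b⟩ := y
  simp only [step_frestrictLe, PMF.mem_support_bind_iff, PMF.mem_support_map_iff, Prod.mk.injEq]
  constructor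
  · rintro ⟨t, ht, b, hb, rfl, rfl⟩
    exact ⟨ht, hb⟩
  · rintro ⟨ht, hb⟩
    exact ⟨t, ht, b, hb, rfl, rfl⟩

lemma isHist_pref {ρ : ℕ → S × A} (hρ : ρ ∈ M.Runs) (n : ℕ) : M.IsHist (pref ρ n) (ρ n).1 := by
  induction n with
  | zero => simp [IsHist, pref]
  | succ n ih =>
    rw [pref_succ]
    refine ⟨List.isChain_append.2 ⟨ih.1, List.isChain_singleton _, ?_⟩, by simpa using hρ n⟩
    intro x hx y hy
    obtain rfl : ρ n = y := by simpa using hy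
    exact ih.2 x hx

lemma ae_mem_support {X : Type*} [MeasurableSpace X] [DiscreteMeasurableSpace X] (p : PMF X) :
    ∀ᵐ x ∂p.toMeasure, x ∈ p.support := by
  rw [ae_iff, PMF.toMeasure_apply_eq_zero_iff _ .of_discrete]
  exact disjoint_compl_right

lemma lintegral_toMeasure {X : Type*} [Countable X] [MeasurableSpace X]
    [DiscreteMeasurableSpace X] (p : PMF X) (f : X → ℝ≥0∞) :
    ∫⁻ x, f x ∂p.toMeasure = ∑' x, p x * f x := by
  rw [lintegral_countable']
  refine tsum_congr fun x => ?_
  rw [PMF.toMeasure_apply_singleton _ _ (measurableSet_singleton x), mul_comm]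

variable [Finite S] [Finite A] [MeasurableSpace S] [MeasurableSpace A]
  [DiscreteMeasurableSpace S] [DiscreteMeasurableSpace A]

instance (σ : M.Strategy) (s : S) : IsProbabilityMeasure (σ.law s) := by
  have := PMF.toMeasure.isProbabilityMeasure ((σ.act (Hist.single M s)).map fun a => (s, a))
  unfold Strategy.law
  infer_instance

lemma Strategy.map_law_zero (σ : M.Strategy) (s : S) :
    (σ.law s).map (fun ρ => ρ 0) = ((σ.actExt [] s).map (Prod.mk s)).toMeasure := by
  have heval : (fun ρ : ℕ → S × A => ρ 0) =
      MeasurableEquiv.piUnique (fun _ : Finset.Iic 0 => S × A) ∘ Preorder.frestrictLe 0 := rfl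
  rw [heval, ← Measure.map_map (by fun_prop) (by fun_prop), law, Kernel.trajMeasure,
    Measure.map_comp _ _ (by fun_prop), Kernel.traj_map_frestrictLe, Kernel.partialTraj_self,
    Measure.id_comp, Measure.map_map (by fun_prop) (by fun_prop), actExt_nil]
  exact Measure.map_id

lemma Strategy.map_law_succ (σ : M.Strategy) (s : S) (n : ℕ) :
    (σ.law s).map (fun ρ => (Preorder.frestrictLe n ρ, ρ (n + 1))) =
      ((σ.law s).map (Preorder.frestrictLe n)) ⊗ₘ σ.kernel n := by
  have := PMF.toMeasure.isProbabilityMeasure ((σ.act (Hist.single M s)).map fun a => (s, a))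
  exact (Kernel.map_frestrictLe_trajMeasure_compProd_eq_map_trajMeasure (X := fun _ => S × A)).symm

lemma Strategy.ae_zero (σ : M.Strategy) (s : S) :
    ∀ᵐ ρ ∂σ.law s, (ρ 0).1 = s ∧ (ρ 0).2 ∈ (σ.actExt [] s).support := by
  have h := ae_mem_support ((σ.actExt [] s).map (Prod.mk s))
  rw [← σ.map_law_zero s] at h
  filter_upwards [ae_of_ae_map (measurable_pi_apply 0).aemeasurable h] with ρ hρ
  obtain ⟨a, ha, h⟩ := (PMF.mem_support_map_iff _ _ _).1 hρ
  rw [← h]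
  exact ⟨rfl, ha⟩

lemma Strategy.ae_mem_support_step (σ : M.Strategy) (s : S) (n : ℕ) :
    ∀ᵐ ρ : ℕ → S × A ∂σ.law s, ρ (n + 1) ∈ (σ.step n (Preorder.frestrictLe n ρ)).support := by
  have h := Measure.ae_compProd_of_ae_ae (μ := (σ.law s).map (Preorder.frestrictLe n))
    (κ := σ.kernel n) (p := fun z => z.2 ∈ (σ.step n z.1).support)
    (MeasurableSet.of_discrete (α := ((i : Finset.Iic n) → S × A) × (S × A)))
    (ae_of_all _ fun x => ae_mem_support (σ.step n x))
  rw [← map_law_succ] at h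
  exact ae_of_ae_map (by fun_prop) h

lemma Strategy.ae_mem_support_actExt (σ : M.Strategy) (s : S) (n : ℕ) :
    ∀ᵐ ρ ∂σ.law s, (ρ n).2 ∈ (σ.actExt (pref ρ n) (ρ n).1).support := by
  cases n with
  | zero => exact (σ.ae_zero s).mono fun ρ hρ => hρ.1.symm ▸ hρ.2
  | succ n => exact (σ.ae_mem_support_step s n).mono fun ρ hρ => (mem_support_step.1 hρ).2

lemma Strategy.ae_mem_avail (σ : M.Strategy) (s : S) (n : ℕ) :
    ∀ᵐ ρ ∂σ.law s, (ρ n).2 ∈ M.avail (ρ n).1 :=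
  (σ.ae_mem_support_actExt s n).mono fun _ h => σ.support_actExt_subset _ _ h

lemma Strategy.ae_mem_runs (σ : M.Strategy) (s : S) : ∀ᵐ ρ ∂σ.law s, ρ ∈ M.Runs := by
  refine ae_all_iff.2 fun n => ?_
  filter_upwards [σ.ae_mem_support_step s n, σ.ae_mem_avail s n] with ρ hρ ha
  obtain ⟨p, hp⟩ := Option.isSome_iff_exists.1 ha
  have hsupp := (mem_support_step.1 hρ).1
  rw [hp, Option.getD_some, PMF.mem_support_iff] at hsupp
  simpa [Edge, prob, hp, pos_iff_ne_zero] using hsupp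

lemma Strategy.lintegral_next_state (σ : M.Strategy) (s : S) (n : ℕ)
    (G : List (S × A) → S → ℝ≥0∞) :
    ∫⁻ ρ, G (pref ρ (n + 1)) (ρ (n + 1)).1 ∂σ.law s =
      ∫⁻ ρ, ∑' t, M.prob (ρ n).1 (ρ n).2 t * G (pref ρ (n + 1)) t ∂σ.law s := by
  let toList (x : (i : Finset.Iic n) → S × A) : List (S × A) :=
    List.ofFn fun i : Fin (n + 1) => x ⟨i, Finset.mem_Iic.2 (Nat.le_of_lt_succ i.2)⟩
  calc ∫⁻ ρ, G (pref ρ (n + 1)) (ρ (n + 1)).1 ∂σ.law s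
      = ∫⁻ z, G (toList z.1) z.2.1
          ∂(σ.law s).map fun ρ => (Preorder.frestrictLe n ρ, ρ (n + 1)) := by
        rw [lintegral_map .of_discrete (by fun_prop)]
        rfl
    _ = ∫⁻ ρ, ∫⁻ y, G (pref ρ (n + 1)) y.1
          ∂(σ.step n (Preorder.frestrictLe n ρ)).toMeasure ∂σ.law s := by
        rw [map_law_succ, Measure.lintegral_compProd .of_discrete,
          lintegral_map .of_discrete (by fun_prop)]
        rfl
    _ = _ := lintegral_congr_ae ?_
  filter_upwards [σ.ae_mem_avail s n] with ρ ha
  obtain ⟨p, hp⟩ := Option.isSome_iff_exists.1 ha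
  have hmap : (σ.step n (Preorder.frestrictLe n ρ)).map Prod.fst = p := by
    have hfst (t : S) : Prod.fst ∘ Prod.mk t = Function.const A t := rfl
    simp only [step_frestrictLe, hp, Option.getD_some, PMF.map_bind, PMF.map_comp, hfst,
      PMF.map_const, PMF.bind_pure]
  rw [← lintegral_map (f := G (pref ρ (n + 1))) .of_discrete measurable_fst,
    PMF.toMeasure_map (f := Prod.fst) _ measurable_fst, hmap, lintegral_toMeasure]
  simp only [prob, hp, Option.elim_some]

end Law

section Selector

instance (M : MDP S A) (s : S) : Nonempty (M.avail s) :=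
  nonempty_subtype.2 (M.deadlockFree s)

/-- A choice of an available action for each state of the product of `M` with an automaton whose
states are `Q`. -/
abbrev Selector (M : MDP S A) (Q : Type*) := ∀ x : S × Q, M.avail x.1

lemma isRational_pure {X : Type*} (x : X) : (PMF.pure x).IsRational := fun y => by
  classical
  exact ⟨if y = x then 1 else 0, by rw [PMF.pure_apply]; split_ifs <;> simp⟩

lemma support_pure_selector_subset (d : M.Selector Q) (x : S × Q) :
    (PMF.pure (d x : A)).support ⊆ M.avail x.1 := by
  rw [PMF.support_pure, Set.singleton_subset_iff]
  exact (d x).2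

/-- The pure strategy that runs the automaton `D` on the history, and plays the action that `d`
chooses for the current state and the state of the automaton. -/
noncomputable def Strategy.ofDFA (D : DFA (S × A) Q) (d : M.Selector Q) : M.Strategy where
  act h := PMF.pure (d (h.last, D.eval h.1.1))
  rational _ := isRational_pure _
  supp h := support_pure_selector_subset d (h.last, D.eval h.1.1)

lemma Strategy.isPure_ofDFA (D : DFA (S × A) Q) (d : M.Selector Q) : (ofDFA D d).IsPure :=
  fun _ => ⟨_, rfl⟩

/-- The Mealy machine with the states of the automaton `D` as its memory that encodes
`Strategy.ofDFA D d`. -/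
noncomputable def Mealy.ofDFA (D : DFA (S × A) Q) (d : M.Selector Q) : M.Mealy Q where
  init := PMF.pure D.start
  next s q := PMF.pure (d (s, q))
  upd a s q := D.step q (s, a)
  init_rational := isRational_pure _
  next_rational _ _ := isRational_pure _
  next_supp s q := support_pure_selector_subset d (s, q)

lemma Mealy.memory_ofDFA (D : DFA (S × A) Q) (d : M.Selector Q) (q : Q) (l : List (S × A)) :
    (ofDFA D d).memory q l = D.evalFrom q l := by
  induction l generalizing q with
  | nil => rfl
  | cons x _ ih => exact ih _

lemma Strategy.isFiniteMemory_ofDFA {Q : Type} [Finite Q] (D : DFA (S × A) Q)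
    (d : M.Selector Q) : (ofDFA D d).IsFiniteMemory := by
  classical
  refine ⟨Q, inferInstance, .ofDFA D d, fun h a => ?_⟩
  have hinit (f : Q → ℝ≥0∞) : ∑' q, (Mealy.ofDFA D d).init q * f q = f D.start := by
    rw [tsum_eq_single D.start fun q hq => by simp [Mealy.ofDFA, hq]]
    simp [Mealy.ofDFA]
  simp only [mul_assoc, hinit, Mealy.memory_ofDFA]
  rfl

/-- The states visited by `ρ` in the product of the decision process with the automaton `D`. -/
def config (D : DFA (S × A) Q) (ρ : ℕ → S × A) (n : ℕ) : S × Q := ((ρ n).1, D.eval (pref ρ n))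

lemma ae_act_ofDFA [Finite S] [Finite A] [MeasurableSpace S] [MeasurableSpace A]
    [DiscreteMeasurableSpace S] [DiscreteMeasurableSpace A] (D : DFA (S × A) Q)
    (d : M.Selector Q) (s : S) (n : ℕ) :
    ∀ᵐ ρ ∂(Strategy.ofDFA D d).law s, (ρ n).2 = d (config D ρ n) := by
  filter_upwards [(Strategy.ofDFA D d).ae_mem_runs s,
    (Strategy.ofDFA D d).ae_mem_support_actExt s n] with ρ hρ hact
  rw [Strategy.actExt, dif_pos (isHist_pref hρ n)] at hact
  exact (PMF.mem_support_pure_iff _ _).1 hact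

end Selector

section ValueIteration

variable {D : DFA (S × A) Q} {γ : ℝ≥0∞} {f : S × Q → ℝ≥0∞}

lemma tsum_prob_le (M : MDP S A) (s : S) (a : A) : ∑' t, M.prob s a t ≤ 1 := by
  unfold prob
  cases M.δ s a with
  | none => simp
  | some p => exact p.tsum_coe.le

open Classical in
/-- The expected value of `f` after the action `a` in the state `x` of the product of `M` with the
automaton `D`, discounted by `γ` if `D` is in an accepting state. -/
noncomputable def qValue (M : MDP S A) (D : DFA (S × A) Q) (γ : ℝ≥0∞) (f : S × Q → ℝ≥0∞)
    (x : S × Q) (a : A) : ℝ≥0∞ :=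
  (if x.2 ∈ D.accept then γ else 1) * ∑' t, M.prob x.1 a t * f (t, D.step x.2 (x.1, a))

/-- The Bellman operator for the maximal expectation of `γ` to the power of the number of visits to
accepting states of the automaton `D`. -/
noncomputable def bellman (M : MDP S A) (D : DFA (S × A) Q) (γ : ℝ≥0∞) (f : S × Q → ℝ≥0∞)
    (x : S × Q) : ℝ≥0∞ :=
  ⨆ a : M.avail x.1, M.qValue D γ f x a

lemma qValue_mono {f g : S × Q → ℝ≥0∞} (hfg : f ≤ g) (x : S × Q) (a : A) :
    M.qValue D γ f x a ≤ M.qValue D γ g x a := by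
  unfold qValue
  gcongr
  exact hfg _

lemma bellman_mono : Monotone (M.bellman D γ) :=
  fun _ _ hfg x => iSup_mono fun a => qValue_mono hfg x a.1

lemma qValue_one_le (hγ : γ ≤ 1) (x : S × Q) (a : A) : M.qValue D γ 1 x a ≤ 1 := by
  simp only [qValue, Pi.one_apply, mul_one]
  refine mul_le_one' ?_ (M.tsum_prob_le _ _)
  split_ifs
  exacts [hγ, le_rfl]

lemma bellman_one_le (hγ : γ ≤ 1) : M.bellman D γ 1 ≤ 1 :=
  fun x => iSup_le fun a => qValue_one_le hγ x a.1

lemma continuous_qValue [Finite S] (hγ : γ ≠ ∞) (x : S × Q) (a : A) :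
    Continuous fun f => M.qValue D γ f x a := by
  have := Fintype.ofFinite S
  have hprob (t : S) : M.prob x.1 a t ≠ ∞ :=
    ne_top_of_le_ne_top ENNReal.one_ne_top ((ENNReal.le_tsum t).trans (M.tsum_prob_le _ _))
  simp only [qValue, tsum_fintype]
  refine (ENNReal.continuous_const_mul ?_).comp <| continuous_finsetSum _ fun t _ =>
    (ENNReal.continuous_const_mul (hprob t)).comp (continuous_apply _)
  split_ifs
  exacts [hγ, ENNReal.one_ne_top]

lemma continuous_bellman [Finite S] [Finite A] (hγ : γ ≠ ∞) : Continuous (M.bellman D γ) := by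
  refine continuous_pi fun x => ?_
  have := Fintype.ofFinite (M.avail x.1)
  simp only [bellman, ← Finset.sup_univ_eq_iSup]
  exact Continuous.finset_sup_apply fun a _ => continuous_qValue hγ x a.1

lemma isFixedPt_iInf_bellman_iterate [Finite S] [Finite A] (hγ : γ ≤ 1) :
    Function.IsFixedPt (M.bellman D γ) (⨅ n, (M.bellman D γ)^[n] 1) :=
  isFixedPt_of_tendsto_iterate
    (tendsto_atTop_iInf (bellman_mono.antitone_iterate_of_map_le (bellman_one_le hγ)))
    (continuous_bellman (ne_top_of_le_ne_top ENNReal.one_ne_top hγ)).continuousAt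

lemma exists_selector_bellman_eq [Finite A] (M : MDP S A) (D : DFA (S × A) Q) (γ : ℝ≥0∞)
    (f : S × Q → ℝ≥0∞) : ∃ d : M.Selector Q, ∀ x, M.qValue D γ f x (d x) = M.bellman D γ f x := by
  choose d hd using fun x =>
    exists_eq_ciSup_of_finite (f := fun a : M.avail x.1 => M.qValue D γ f x a)
  exact ⟨d, hd⟩

end ValueIteration

section Discounted

variable [Finite S] [Finite A] [MeasurableSpace S] [MeasurableSpace A]
  [DiscreteMeasurableSpace S] [DiscreteMeasurableSpace A]
  {D : DFA (S × A) Q} {γ : ℝ≥0∞} {f : S × Q → ℝ≥0∞}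

lemma lintegral_pow_visits_zero (σ : M.Strategy) (s : S) :
    ∫⁻ ρ, γ ^ visits D.accepts (pref ρ 0) * f (config D ρ 0) ∂σ.law s = f (s, D.start) := by
  have hconst : ∀ᵐ ρ ∂σ.law s,
      γ ^ visits D.accepts (pref ρ 0) * f (config D ρ 0) = f (s, D.start) := by
    filter_upwards [σ.ae_zero s] with ρ hρ
    have hvisits : visits D.accepts (pref ρ 0) = 0 := rfl
    have hconfig : config D ρ 0 = (s, D.start) := Prod.ext hρ.1 rfl
    rw [hvisits, hconfig, pow_zero, one_mul]
  rw [lintegral_congr_ae hconst, lintegral_const, measure_univ, mul_one]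

lemma lintegral_pow_visits_succ (σ : M.Strategy) (s : S) (n : ℕ) :
    ∫⁻ ρ, γ ^ visits D.accepts (pref ρ (n + 1)) * f (config D ρ (n + 1)) ∂σ.law s =
      ∫⁻ ρ, γ ^ visits D.accepts (pref ρ n) * M.qValue D γ f (config D ρ n) (ρ n).2 ∂σ.law s := by
  classical
  refine (σ.lintegral_next_state s n
    fun l t => γ ^ visits D.accepts l * f (t, D.eval l)).trans (lintegral_congr fun ρ => ?_)
  have hstep : D.eval (pref ρ (n + 1)) = D.step (D.eval (pref ρ n)) ((ρ n).1, (ρ n).2) := by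
    rw [pref_succ, DFA.eval_append_singleton]
  have hpow : γ ^ visits D.accepts (pref ρ (n + 1)) =
      γ ^ visits D.accepts (pref ρ n) * if (config D ρ n).2 ∈ D.accept then γ else 1 := by
    rw [visits_pref_succ, pow_add, pow_ite, pow_one, pow_zero]
    rfl
  simp only [mul_left_comm (M.prob _ _ _), ENNReal.tsum_mul_left, hstep, hpow, mul_assoc, qValue]
  rfl

lemma lintegral_pow_visits_le_bellman_iterate (σ : M.Strategy) (s : S) (n : ℕ) :
    ∫⁻ ρ, γ ^ visits D.accepts (pref ρ n) * f (config D ρ n) ∂σ.law s ≤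
      (M.bellman D γ)^[n] f (s, D.start) := by
  induction n generalizing f with
  | zero => exact (lintegral_pow_visits_zero σ s).le
  | succ n ih =>
    rw [lintegral_pow_visits_succ, Function.iterate_succ_apply]
    refine (lintegral_mono_ae ?_).trans ih
    filter_upwards [σ.ae_mem_avail s n] with ρ ha
    gcongr
    exact le_iSup (fun a : M.avail (ρ n).1 => M.qValue D γ f (config D ρ n) a) ⟨_, ha⟩

lemma lintegral_pow_visits_ofDFA {d : M.Selector Q} (hd : ∀ x, M.qValue D γ f x (d x) = f x)
    (s : S) (n : ℕ) :
    ∫⁻ ρ, γ ^ visits D.accepts (pref ρ n) * f (config D ρ n) ∂(Strategy.ofDFA D d).law s =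
      f (s, D.start) := by
  induction n with
  | zero => exact lintegral_pow_visits_zero _ s
  | succ n ih =>
    rw [lintegral_pow_visits_succ, ← ih]
    refine lintegral_congr_ae ?_
    filter_upwards [ae_act_ofDFA D d s n] with ρ hρ
    rw [hρ, hd]

lemma pow_mul_law_visits_le_le (hγ : γ ≤ 1) (σ : M.Strategy) (s : S) (m : ℕ) :
    γ ^ m * σ.law s {ρ | ∀ n, visits D.accepts (pref ρ n) ≤ m} ≤
      (⨅ n, (M.bellman D γ)^[n] 1) (s, D.start) := by
  rw [iInf_apply]
  refine le_iInf fun n => ?_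
  calc γ ^ m * σ.law s {ρ | ∀ n, visits D.accepts (pref ρ n) ≤ m}
      = ∫⁻ ρ, {ρ | ∀ n, visits D.accepts (pref ρ n) ≤ m}.indicator (fun _ => γ ^ m) ρ
          ∂σ.law s :=
        (lintegral_indicator_const (measurableSet_visits_le _ m) _).symm
    _ ≤ ∫⁻ ρ, γ ^ visits D.accepts (pref ρ n) * (1 : S × Q → ℝ≥0∞) (config D ρ n) ∂σ.law s := by
        refine lintegral_mono <| Set.indicator_le' (fun ρ hρ => ?_) fun _ _ => zero_le
        rw [Pi.one_apply, mul_one]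
        exact pow_le_pow_right_of_le_one' hγ (hρ n)
    _ ≤ (M.bellman D γ)^[n] 1 (s, D.start) := lintegral_pow_visits_le_bellman_iterate σ s n

lemma le_law_ofDFA_coBuchi (hγ : γ < 1) {d : M.Selector Q} (hf : f ≤ 1)
    (hd : ∀ x, M.qValue D γ f x (d x) = f x) (s : S) :
    f (s, D.start) ≤ (Strategy.ofDFA D d).law s (coBuchi D.accepts) := by
  have hmeas (n : ℕ) : Measurable fun ρ : ℕ → S × A => γ ^ visits D.accepts (pref ρ n) :=
    measurable_comp_pref (fun l => γ ^ visits D.accepts l) n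
  have hanti : Antitone fun n (ρ : ℕ → S × A) => γ ^ visits D.accepts (pref ρ n) :=
    fun m n hmn ρ => pow_le_pow_right_of_le_one' hγ.le (visits_pref_mono _ ρ hmn)
  have hfinite : ∫⁻ ρ, γ ^ visits D.accepts (pref ρ 0) ∂(Strategy.ofDFA D d).law s ≠ ∞ := by
    change ∫⁻ _, γ ^ 0 ∂_ ≠ ∞
    simp
  calc f (s, D.start)
      ≤ ⨅ n, ∫⁻ ρ, γ ^ visits D.accepts (pref ρ n) ∂(Strategy.ofDFA D d).law s := by
        refine le_iInf fun n => ?_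
        rw [← lintegral_pow_visits_ofDFA hd s n]
        exact lintegral_mono fun ρ => mul_le_of_le_one_right' (hf _)
    _ = ∫⁻ ρ, ⨅ n, γ ^ visits D.accepts (pref ρ n) ∂(Strategy.ofDFA D d).law s :=
        (lintegral_iInf hmeas hanti hfinite).symm
    _ ≤ ∫⁻ ρ, (coBuchi D.accepts).indicator 1 ρ ∂(Strategy.ofDFA D d).law s :=
        lintegral_mono fun ρ => iInf_pow_visits_le _ hγ ρ
    _ = (Strategy.ofDFA D d).law s (coBuchi D.accepts) :=
        lintegral_indicator_one (measurableSet_coBuchi _)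

lemma exists_selector_pow_mul_law_visits_le (M : MDP S A) (D : DFA (S × A) Q) (hγ : γ < 1) :
    ∃ d : M.Selector Q, ∀ (σ : M.Strategy) (s : S) (m : ℕ),
      γ ^ m * σ.law s {ρ | ∀ n, visits D.accepts (pref ρ n) ≤ m} ≤
        (Strategy.ofDFA D d).law s (coBuchi D.accepts) := by
  obtain ⟨d, hd⟩ := exists_selector_bellman_eq M D γ (⨅ n, (M.bellman D γ)^[n] 1)
  rw [isFixedPt_iInf_bellman_iterate hγ.le] at hd
  exact ⟨d, fun σ s m => (pow_mul_law_visits_le_le hγ.le σ s m).trans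
    (le_law_ofDFA_coBuchi hγ (iInf_le _ 0) hd s)⟩

end Discounted

section CoBuchi

variable [Finite S] [Finite A] [MeasurableSpace S] [MeasurableSpace A]
  [DiscreteMeasurableSpace S] [DiscreteMeasurableSpace A]

lemma law_coBuchi_le {L : Language (S × A)} {σ : M.Strategy} {s : S} {c : ℝ≥0∞}
    (h : ∀ m, ∃ᶠ γ in 𝓝[<] (1 : ℝ≥0∞),
      γ ^ m * σ.law s {ρ | ∀ n, visits L (pref ρ n) ≤ m} ≤ c) :
    σ.law s (coBuchi L) ≤ c := by
  have hmono : Monotone fun m => {ρ : ℕ → S × A | ∀ n, visits L (pref ρ n) ≤ m} :=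
    fun _ _ hm _ hρ n => (hρ n).trans hm
  rw [coBuchi_eq_iUnion, hmono.measure_iUnion]
  refine iSup_le fun m => ?_
  have hlim : Tendsto (fun γ => γ ^ m * σ.law s {ρ | ∀ n, visits L (pref ρ n) ≤ m}) (𝓝 1)
      (𝓝 (σ.law s {ρ | ∀ n, visits L (pref ρ n) ≤ m})) := by
    simpa using ENNReal.Tendsto.mul_const ((ENNReal.continuous_pow m).tendsto 1) (by simp)
  exact le_of_tendsto_of_frequently (hlim.mono_left nhdsWithin_le_nhds) (h m)

lemma exists_selector_forall_law_coBuchi_le [Finite Q] (M : MDP S A) (D : DFA (S × A) Q) :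
    ∃ d : M.Selector Q, ∀ (σ : M.Strategy) (s : S),
      σ.law s (coBuchi D.accepts) ≤ (Strategy.ofDFA D d).law s (coBuchi D.accepts) := by
  have hselector : ∀ᶠ γ in 𝓝[<] (1 : ℝ≥0∞), ∃ d : M.Selector Q, ∀ (σ : M.Strategy) (s : S) (m : ℕ),
      γ ^ m * σ.law s {ρ | ∀ n, visits D.accepts (pref ρ n) ≤ m} ≤
        (Strategy.ofDFA D d).law s (coBuchi D.accepts) := by
    filter_upwards [self_mem_nhdsWithin] with γ hγ
    exact exists_selector_pow_mul_law_visits_le M D hγ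
  obtain ⟨d, hd⟩ := frequently_exists.1 hselector.frequently
  exact ⟨d, fun σ s => law_coBuchi_le fun m => hd.mono fun _ h => h σ s m⟩

lemma exists_isPure_isFiniteMemory_forall_law_coBuchi_le (M : MDP S A) {L : Language (S × A)}
    (hL : L.IsRegular) :
    ∃ σ' : M.Strategy, σ'.IsPure ∧ σ'.IsFiniteMemory ∧
      ∀ (σ : M.Strategy) (s : S), σ.law s (coBuchi L) ≤ σ'.law s (coBuchi L) := by
  obtain ⟨Q, _, D, rfl⟩ := hL
  obtain ⟨d, hd⟩ := exists_selector_forall_law_coBuchi_le M D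
  exact ⟨.ofDFA D d, Strategy.isPure_ofDFA D d, Strategy.isFiniteMemory_ofDFA D d, hd⟩

end CoBuchi

end MDP

open MDP in
theorem theorem4p4_general {S A : Type*} [Finite S] [Finite A]
    [MeasurableSpace S] [MeasurableSpace A]
    [DiscreteMeasurableSpace S] [DiscreteMeasurableSpace A]
    (M : MDP S A) (Ω : MDP.Variant S A) (lam : ℕ)
    {E : Set (ℕ → S × A)} (hE : E = M.DFW Ω lam ∨ E = M.FW Ω lam) :
    ∃ σ' : M.Strategy, σ'.IsPure ∧ σ'.IsFiniteMemory ∧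
      ∀ (σ : M.Strategy) (s : S), (σ.law s).real E ≤ (σ'.law s).real E := by
  obtain ⟨L, hL, hEL⟩ := exists_isRegular_forall_mem_iff_coBuchi hE
  have hlaw (σ : M.Strategy) (s : S) : σ.law s E = σ.law s (coBuchi L) :=
    measure_congr ((σ.ae_mem_runs s).mono fun ρ hρ => propext (hEL ρ hρ))
  obtain ⟨σ', hpure, hfin, hopt⟩ := exists_isPure_isFiniteMemory_forall_law_coBuchi_le M hL
  refine ⟨σ', hpure, hfin, fun σ s => ENNReal.toReal_mono (measure_ne_top _ _) ?_⟩
  rw [hlaw, hlaw]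
  exact hopt σ s

theorem theorem4p4 {S A : Type*} [Finite S] [Finite A]
    [MeasurableSpace S] [MeasurableSpace A]
    [DiscreteMeasurableSpace S] [DiscreteMeasurableSpace A]
    (M : MDP S A) (s : S) (Ω : MDP.Variant S A) (lam : ℕ) (hlam : 0 < lam)
    (E : Set (ℕ → S × A)) (hE : E = M.DFW Ω lam ∨ E = M.FW Ω lam)
    (α : ℚ) (hα0 : 0 ≤ α) (hα1 : α ≤ 1)
    (hσ : ∃ σ : M.Strategy, (α : ℝ) ≤ (σ.law s).real E) :
    ∃ σ' : M.Strategy, σ'.IsPure ∧ σ'.IsFiniteMemory ∧ (α : ℝ) ≤ (σ'.law s).real E := by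
  obtain ⟨σ', hpure, hfin, hopt⟩ := theorem4p4_general M Ω lam hE
  exact ⟨σ', hpure, hfin, hσ.elim fun σ hα => hα.trans (hopt σ s)⟩
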